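/- \textbf{Setting (plane-wide breakout).} The plane is covered by the unit-square bricks $[a,a+1]\times[b,b+1]$, $(a,b)\in\mathbb Z^2\setminus\{(-1,0)\}$. A ball is launched northeast from $(0,y)$ with slope $S$, where $0<y<S<1$ and the orbit never meets $\mathbb Z^2$. When the ball hits a brick, the brick is destroyed. If it was hit on a vertical edge, the horizontal direction of the ball is reversed (so the brick $[0,1]^2$ is destroyed at distance $0$); if it was hit on a horizontal edge, the remaining bricks are reflected along the line carrying that edge and the ball continues upward. Let $(T_x(n),T_y(n))$ be the position of the ball after it has travelled the horizontal distance $n\in\mathbb N$; thus $T_x(n)\in\mathbb Z$ and $T_y(n)=y+Sn$. \textbf{Slices.} The slicing sequence $(\chi_n)_{n\in\mathbb N}$ of $(S,y)$ is given by $\chi_n=\#\{m\in\mathbb N: n<T_y(m)<n+1\}$; it takes at most two values. The leading slice $\chi$ is its most frequent term (for asymptotic frequencies), and the correcting slice $\chi'$ is its other, less frequent, term, if there is one. \textbf{Blocks.} For integers $0\le\rho\le\alpha$ put $|\alpha,\rho|=\frac{\alpha(\alpha+1)}2+\rho+1$ and $X(|\alpha,\rho|)=\sum_{0<n\le\alpha}(-1)^n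 n+(-1)^{\alpha+1}(\rho+1)$. A ternary block is a triple $\Delta=((\alpha_i,\rho_i))_{0\le i\le2}$ of such pairs for which there are $0<y_*<S_*<1$ with $i+1<y_*+S_*|\alpha_i,\rho_i|<i+1+S_*$ for $i=0,1,2$. Write $|\Delta|=|\alpha_2,\rho_2|$, and $\Delta=(a,b,c)$ if $|\alpha_0,\rho_0|=a$, $|\alpha_1,\rho_1|=a+b$ and $|\alpha_2,\rho_2|=a+b+c$. The block is elementary if $\alpha_2-2\rho_2=\alpha_0-2\rho_0$ when $\alpha_0,\alpha_2$ have the same parity, and $\alpha_2-2\rho_2=-\alpha_0+2\rho_0+1$ otherwise. \textbf{Elementary sequences.} A sequence $(\Delta_N)_{N\in\mathbb N}$ of elementary blocks $\Delta_N=((\alpha_{i,N},\rho_{i,N}))_{0\le i\le2}$ is an elementary sequence of $S$ (with initial ordinate $y$) if the orbit goes successively through these blocks, that is, with $\Sigma_N=\sum_{j<N}|\Delta_j|$ and $\alpha_N=\sum_{j<N}(\alpha_{2,j}+1)$, for all $N\in\mathbb N$ and $i\in\{0,1,2\}$, $$3N+i+1<T_y(\Sigma_N+|\alpha_{i,N},\rho_{i,N}|)<3N+i+1+S,$$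 $$T_x(\Sigma_N+|\alpha_{i,N},\rho_{i,N}|)=T_x(\Sigma_N)+(-1)^{\alpha_N}X(|\alpha_{i,N},\rho_{i,N}|).$$ \textbf{Lemma.} Every elementary sequence $(\Delta_N)$ of a slope $S$ with initial ordinate $y$ is (purely) periodic, and the slicing sequence has a leading slice $\chi$. If the minimal period has length $1$, then it is one of $\Lambda=(\chi,\chi,\chi)$, $\Lambda_0=(\chi',\chi,\chi)$, $\Lambda_1=(\chi,\chi',\chi)$, $\Lambda_2=(\chi,\chi,\chi')$, where $\chi'$ is the correcting slice (which exists in the last three cases). If the minimal period has length $>1$, then the correcting slice $\chi'$ exists and the minimal period is, up to circular permutation, $\Lambda^k\Lambda_0$ for some integer $k>0$. -/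

import Mathlib

open Filter Topology

namespace Breakout

/-! ### The breakout dynamics

The ball starts on the left edge of the brick `[0,1] × [0,1]`, travelling northeast, and the
brick `[-1,0] × [0,1]` is missing. Hitting a vertical edge reverses the horizontal direction.
Hitting a horizontal edge reflects all remaining bricks (instead of the ball) along the line that
carries this edge, so that the ordinate of the ball always increases. In both cases the brick that
was hit is destroyed. The orbit is observed at the times (horizontal distances travelled)
`0, 1, 2, …`, when the abscissa is an integer. -/

/-- A state of the game when the ball is at a point with integer abscissa (just before a possible
hit on a vertical edge). The brick `[a, a+1] × [b, b+1]` is represented by `(a, b)`. -/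
structure State where
  /-- abscissa of the ball -/
  x : ℤ
  /-- ordinate of the ball -/
  y : ℝ
  /-- the ball travels east -/
  east : Prop
  /-- the remaining bricks -/
  bricks : Set (ℤ × ℤ)

/-- The column of unit squares in front of a ball with integer abscissa `x`. -/
noncomputable def column (x : ℤ) (east : Prop) : ℤ :=
  open Classical in if east then x else x - 1

/-- If the unit square in front of the ball is a brick, the ball hits it on a vertical edge: the
brick is destroyed and the horizontal direction of the ball is reversed. -/
noncomputable def State.hitVertical (s : State) : State :=
  open Classical in
  if (column s.x s.east, ⌊s.y⌋) ∈ s.bricks then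
    { s with
      east := ¬ s.east
      bricks := s.bricks \ {(column s.x s.east, ⌊s.y⌋)} }
  else s

/-- The image of a set of bricks under the reflection along the horizontal line of ordinate `L`,
which sends `[a, a+1] × [b, b+1]` to `[a, a+1] × [2L-b-1, 2L-b]`. -/
def reflectBricks (L : ℤ) (B : Set (ℤ × ℤ)) : Set (ℤ × ℤ) :=
  {p | (p.1, 2 * L - 1 - p.2) ∈ B}

/-- The ball travels a horizontal distance `1` inside a column, with slope `S`. If it reaches the
line of ordinate `L = ⌊y⌋ + 1` on the way (since `S < 1` it reaches no other such line) and the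
unit square above is a brick, this brick is hit on a horizontal edge: it is destroyed and the
remaining bricks are reflected along that line. -/
noncomputable def State.travel (S : ℝ) (s : State) : State :=
  open Classical in
  { x := if s.east then s.x + 1 else s.x - 1
    y := s.y + S
    east := s.east
    bricks :=
      if ((⌊s.y⌋ + 1 : ℤ) : ℝ) ≤ s.y + S ∧ (column s.x s.east, ⌊s.y⌋ + 1) ∈ s.bricks then
        reflectBricks (⌊s.y⌋ + 1) (s.bricks \ {(column s.x s.east, ⌊s.y⌋ + 1)})
      else s.bricks }

/-- The state of the game after the ball, launched northeast from `(0, y)` with slope `S`, has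
travelled the horizontal distance `n`. -/
noncomputable def orbit (S y : ℝ) : ℕ → State
  | 0 => { x := 0, y := y, east := True, bricks := {p | p ≠ (-1, 0)} }
  | n + 1 => ((orbit S y n).hitVertical).travel S

/-- The travelling abscissa `T_x`. -/
noncomputable def Tx (S y : ℝ) (n : ℕ) : ℤ := (orbit S y n).x

/-- The travelling ordinate `T_y`. -/
noncomputable def Ty (S y : ℝ) (n : ℕ) : ℝ := (orbit S y n).y

theorem Ty_eq (S y : ℝ) (n : ℕ) : Ty S y n = y + S * n := by
  induction n with
  | zero => simp [Ty, orbit]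
  | succ n ih =>
    have h : Ty S y (n + 1) = Ty S y n + S := by
      simp only [Ty, orbit, State.travel, State.hitVertical]
      split_ifs <;> rfl
    rw [h, ih]
    push_cast
    ring

/-- The initial ordinate lies in `(0, S)`, the slope in `(0, 1)`, and the orbit does not meet
`ℤ × ℤ`. -/
def IsAdmissible (S y : ℝ) : Prop :=
  0 < y ∧ y < S ∧ S < 1 ∧ ∀ (n : ℕ) (z : ℤ), Ty S y n ≠ z

/-! ### The slicing sequence -/

/-- The `n`-th term of the slicing sequence: the number of points of integer abscissa that the
orbit meets between the `n`-th and the `(n+1)`-th line of integer ordinate. -/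
noncomputable def slice (S y : ℝ) (n : ℕ) : ℕ :=
  {m : ℕ | (n : ℝ) < Ty S y m ∧ Ty S y m < n + 1}.ncard

/-- The term `a` has (asymptotic) frequency `d` in the sequence `u`. -/
def HasFrequency (u : ℕ → ℕ) (a : ℕ) (d : ℝ) : Prop :=
  Tendsto (fun n : ℕ => (((Finset.range n).filter (fun j => u j = a)).card : ℝ) / n) atTop (𝓝 d)

/-- `a` is a most frequent term of the slicing sequence. -/
def IsLeadingSlice (S y : ℝ) (a : ℕ) : Prop :=
  a ∈ Set.range (slice S y) ∧
    ∃ d, HasFrequency (slice S y) a d ∧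
      ∀ b ∈ Set.range (slice S y), ∃ e ≤ d, HasFrequency (slice S y) b e

/-- `a` is the leading slice and `b` is the other, less frequent, term of the slicing sequence. -/
def IsLeadingAndCorrecting (S y : ℝ) (a b : ℕ) : Prop :=
  IsLeadingSlice S y a ∧ b ∈ Set.range (slice S y) ∧ b ≠ a

/-! ### Blocks -/

/-- `|α, ρ| = α(α+1)/2 + (ρ+1)`, for `p = (α, ρ)`. -/
def size (p : ℕ × ℕ) : ℕ := p.1 * (p.1 + 1) / 2 + (p.2 + 1)

/-- `X(|α, ρ|) = (∑_{0<n≤α} (-1)^n n) + (-1)^(α+1) (ρ+1)`, for `p = (α, ρ)`. -/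
def X (p : ℕ × ℕ) : ℤ :=
  (∑ n ∈ Finset.Icc 1 p.1, (-1 : ℤ) ^ n * n) + (-1) ^ (p.1 + 1) * (p.2 + 1)

/-- Triples `((α₀, ρ₀), (α₁, ρ₁), (α₂, ρ₂))`. -/
abbrev Block : Type := Fin 3 → ℕ × ℕ

/-- The slope `S` is primary for `Δ`. -/
def IsPrimary (S : ℝ) (Δ : Block) : Prop :=
  0 < S ∧ S < 1 ∧ ∃ y : ℝ, 0 < y ∧ y < S ∧
    ∀ i : Fin 3, ((i : ℕ) : ℝ) + 1 < Ty S y (size (Δ i)) ∧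
      Ty S y (size (Δ i)) < ((i : ℕ) : ℝ) + 1 + S

def IsTernary (Δ : Block) : Prop :=
  (∀ i, (Δ i).2 < (Δ i).1 + 1) ∧ ∃ S, IsPrimary S Δ

/-- A ternary block such that `α₂ - 2ρ₂ = α₀ - 2ρ₀` if `α₀, α₂` have the same parity, and
`α₂ - 2ρ₂ = -α₀ + 2ρ₀ + 1` otherwise. -/
def IsElementaryBlock (Δ : Block) : Prop :=
  IsTernary Δ ∧
  ((Δ 0).1 % 2 = (Δ 2).1 % 2 →
    ((Δ 2).1 : ℤ) - 2 * (Δ 2).2 = (Δ 0).1 - 2 * (Δ 0).2) ∧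
  ((Δ 0).1 % 2 ≠ (Δ 2).1 % 2 →
    ((Δ 2).1 : ℤ) - 2 * (Δ 2).2 = -(Δ 0).1 + 2 * (Δ 0).2 + 1)

/-- `Δ = (a, b, c)` in terms of slices: `|α₀, ρ₀| = a`, `|α₁, ρ₁| - |α₀, ρ₀| = b` and
`|α₂, ρ₂| - |α₁, ρ₁| = c`. -/
def HasSlices (Δ : Block) (a b c : ℕ) : Prop :=
  size (Δ 0) = a ∧ size (Δ 1) = size (Δ 0) + b ∧ size (Δ 2) = size (Δ 1) + c

/-! ### Elementary sequences -/

/-- `α_N = ∑_{j<N} (α_{2,j} + 1)`. -/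
def alphaSum (Δ : ℕ → Block) (N : ℕ) : ℕ := ∑ j ∈ Finset.range N, ((Δ j 2).1 + 1)

/-- `Σ_N = ∑_{j<N} |Δ_j|`, where `|Δ_j| = |α_{2,j}, ρ_{2,j}|`. -/
def sizeSum (Δ : ℕ → Block) (N : ℕ) : ℕ := ∑ j ∈ Finset.range N, size (Δ j 2)

/-- `Δ` is an elementary sequence of the slope `S`, for the initial ordinate `y`: the orbit goes
successively through the elementary blocks `Δ 0, Δ 1, …`, that is, during the `N`-th block it
reaches the lines of ordinates `3N+1, 3N+2, 3N+3` just before the horizontal distances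
`Σ_N + |α_{i,N}, ρ_{i,N}|`, and its abscissa at these distances is that of the block. -/
structure IsElementarySequence (S y : ℝ) (Δ : ℕ → Block) : Prop where
  admissible : IsAdmissible S y
  elementary : ∀ N, IsElementaryBlock (Δ N)
  ordinate : ∀ (N : ℕ) (i : Fin 3),
    (3 * N + (i : ℕ) + 1 : ℝ) < Ty S y (sizeSum Δ N + size (Δ N i)) ∧
      Ty S y (sizeSum Δ N + size (Δ N i)) < (3 * N + (i : ℕ) + 1 : ℝ) + S
  abscissa : ∀ (N : ℕ) (i : Fin 3),
    Tx S y (sizeSum Δ N + size (Δ N i)) =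
      Tx S y (sizeSum Δ N) + (-1) ^ alphaSum Δ N * X (Δ N i)

/-- `T` is the length of the minimal period of the (purely periodic) sequence `u`. -/
def IsMinimalPeriod {β : Type*} (u : ℕ → β) (T : ℕ) : Prop :=
  IsLeast {t : ℕ | 0 < t ∧ Function.Periodic u t} T

end Breakout

namespace Breakout

/-! ### Arithmetic of elementary blocks -/

/-! Only the ordinates matter for the periods. The slices take the values k and k + 1, where k is
the integral part of 1/S, and they form a balanced sequence in which k + 1 has frequency β = 1/S -
k. A block is determined by its three slices, so everything reduces to knowing which triples can
occur together.

With A = α₀ + 1 and C = α₂ + 1, the elementary condition on a block (a, b, c) reads C² - A² = 2(b +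
c) if A and C have the same parity, and A² + C² + 1 = 2(2a + b + c) otherwise. Comparing two such
equations with the bounds A(A - 1) + 2 ≤ 2a ≤ A(A + 1) shows that some pairs of blocks exclude each
other: a constant block and one with the same first slice and exactly one deviating later slice
(`not_elementary_of_const_low`, `not_elementary_of_const_high`), and two blocks having respectively
one and two slices k + 1 (`not_elementary_of_weights_one_two`).

By balance, the number of slices k + 1 in a block is one of the two integers around 3β, and both
occur if 3β is not an integer. Hence 1 < 3β < 2 is impossible. For 0 < 3β < 1 and 2 < 3β < 3 a
constant block occurs, so the rarer slice can only open a block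
(`IsElementarySequence.exists_coding`). A balanced sequence whose rarer letter is confined to
multiples of 3 has constant gaps 3q between these letters (`IsBalancedCoding.exists_gap`), which
gives the period Λ^(q-1) Λ₀ up to rotation. If 3β is an integer, the slices have period 1 or 3 and
the block sequence is constant. -/

/-- `A` is the index `α + 1` of the pair `(α, ρ)` of size `a`. -/
def HasRoot (a A : ℤ) : Prop := 1 ≤ A ∧ A * (A - 1) + 2 ≤ 2 * a ∧ 2 * a ≤ A * (A + 1)

theorem two_mul_size (p : ℕ × ℕ) :
    (2 * size p : ℤ) = p.1 * (p.1 + 1) + 2 * (p.2 + 1) := by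
  have h : 2 * (p.1 * (p.1 + 1) / 2) = p.1 * (p.1 + 1) :=
    Nat.mul_div_cancel' (Nat.even_mul_succ_self p.1).two_dvd
  unfold size
  push_cast
  zify at h
  linarith

theorem hasRoot_size {p : ℕ × ℕ} (hp : p.2 < p.1 + 1) : HasRoot (size p) (p.1 + 1) := by
  have h := two_mul_size p
  have h' : (p.2 : ℤ) < p.1 + 1 := by exact_mod_cast hp
  refine ⟨by omega, ?_, ?_⟩ <;> rw [h] <;> nlinarith

theorem HasRoot.mono {a b A B : ℤ} (hA : HasRoot a A) (hB : HasRoot b B) (h : a ≤ b) : A ≤ B := by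
  obtain ⟨h1, h2, h3⟩ := hA
  obtain ⟨h4, h5, h6⟩ := hB
  by_contra! hlt
  nlinarith

/-- Combined with monotonicity and a parity condition, this forces the root to jump by exactly 1
between two consecutive sizes. -/
theorem HasRoot.le_add_one {a A B : ℤ} (hA : HasRoot a A) (hB : HasRoot (a + 1) B) :
    B ≤ A + 1 := by
  obtain ⟨h1, h2, h3⟩ := hA
  obtain ⟨h4, h5, h6⟩ := hB
  by_contra! hlt
  nlinarith

theorem HasRoot.unique {a A B : ℤ} (hA : HasRoot a A) (hB : HasRoot a B) : A = B :=
  le_antisymm (hA.mono hB le_rfl) (hB.mono hA le_rfl)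

theorem size_injOn {p q : ℕ × ℕ} (hp : p.2 < p.1 + 1) (hq : q.2 < q.1 + 1)
    (h : size p = size q) : p = q := by
  have h1 : (p.1 + 1 : ℤ) = q.1 + 1 :=
    (hasRoot_size hp).unique (by rw [h]; exact hasRoot_size hq)
  have h2 : p.1 = q.1 := by omega
  have h3 := two_mul_size p
  have h4 := two_mul_size q
  rw [h, h2] at h3
  exact Prod.ext h2 (by omega)

theorem HasSlices.block_unique {Δ Δ' : Block} {a b c : ℕ} (h : HasSlices Δ a b c)
    (h' : HasSlices Δ' a b c) (hΔ : IsElementaryBlock Δ) (hΔ' : IsElementaryBlock Δ') :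
    Δ = Δ' := by
  obtain ⟨h0, h1, h2⟩ := h
  obtain ⟨h0', h1', h2'⟩ := h'
  funext i
  refine size_injOn (hΔ.1.1 i) (hΔ'.1.1 i) ?_
  fin_cases i
  · exact h0.trans h0'.symm
  · exact h1.trans (by rw [h0]; exact (h1'.trans (by rw [h0'])).symm)
  · exact h2.trans (by rw [h1, h0]; exact (h2'.trans (by rw [h1', h0'])).symm)

/-! ### Squares modulo 4, and pairs of elementary blocks that exclude each other -/

theorem four_mul_ne_of_odd_add {A C m : ℤ} (h : (A + C) % 2 = 1) : A ^ 2 + C ^ 2 + 1 ≠ 4 * m := by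
  intro hm
  rcases Int.emod_two_eq_zero_or_one A with hA | hA
  · obtain ⟨a, rfl⟩ : ∃ a, A = 2 * a := ⟨A / 2, by omega⟩
    obtain ⟨c, rfl⟩ : ∃ c, C = 2 * c + 1 := ⟨C / 2, by omega⟩
    ring_nf at hm
    omega
  · obtain ⟨a, rfl⟩ : ∃ a, A = 2 * a + 1 := ⟨A / 2, by omega⟩
    obtain ⟨c, rfl⟩ : ∃ c, C = 2 * c := ⟨C / 2, by omega⟩
    ring_nf at hm
    omega

theorem sq_sub_sq_ne_of_even_add {A C m : ℤ} (h : (A + C) % 2 = 0) :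
    C ^ 2 - A ^ 2 ≠ 4 * m + 2 := by
  obtain ⟨d, hd⟩ : ∃ d, C = A + 2 * d := ⟨(C - A) / 2, by omega⟩
  subst hd
  intro hm
  ring_nf at hm
  have : A * d * 4 + d ^ 2 * 4 = 4 * (A * d + d ^ 2) := by ring
  omega

/-- The roots of the first and last sizes of an elementary block, and the relation between them. -/
theorem IsElementaryBlock.exists_roots {Δ : Block} (hΔ : IsElementaryBlock Δ) {a b c : ℕ}
    (h : HasSlices Δ a b c) : ∃ A C : ℤ, HasRoot a A ∧ HasRoot (a + b + c) C ∧
      ((A + C) % 2 = 0 ∧ C ^ 2 - A ^ 2 = 2 * (b + c) ∨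
       (A + C) % 2 = 1 ∧ A ^ 2 + C ^ 2 + 1 = 2 * (2 * a + b + c)) := by
  obtain ⟨h0, h1, h2⟩ := h
  obtain ⟨⟨hρ, -⟩, hs, hd⟩ := hΔ
  have r0 := hasRoot_size (hρ 0)
  have r2 := hasRoot_size (hρ 2)
  have e0 := two_mul_size (Δ 0)
  have e2 := two_mul_size (Δ 2)
  rw [h2, h1, h0] at r2 e2
  rw [h0] at r0 e0
  push_cast at r2 e2
  refine ⟨_, _, r0, r2, ?_⟩
  by_cases hp : (Δ 0).1 % 2 = (Δ 2).1 % 2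
  · have := hs hp
    exact Or.inl ⟨by omega, by nlinarith⟩
  · have := hd hp
    exact Or.inr ⟨by omega, by nlinarith⟩

/-- With equal last slices, roots of different parities would make A² + C² + 1, which is 2 modulo 4,
a multiple of 4. -/
theorem IsElementaryBlock.exists_roots_of_eq {Δ : Block} (hΔ : IsElementaryBlock Δ) {a b : ℕ}
    (h : HasSlices Δ a b b) : ∃ A C : ℤ, HasRoot a A ∧ HasRoot (a + b + b) C ∧
      (A + C) % 2 = 0 ∧ C ^ 2 - A ^ 2 = 4 * b := by
  obtain ⟨A, C, hA, hC, ⟨h1, h2⟩ | ⟨h1, h2⟩⟩ := hΔ.exists_roots h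
  · exact ⟨A, C, hA, hC, h1, by linarith⟩
  · exact absurd (h2.trans (by ring)) (four_mul_ne_of_odd_add (m := a + b) h1)

/-- Squares of the same parity differ by a multiple of 4, whereas 2(b + c) is 2 modulo 4. -/
theorem IsElementaryBlock.exists_roots_of_ne {Δ : Block} (hΔ : IsElementaryBlock Δ) {a b c k : ℕ}
    (h : HasSlices Δ a b c) (hbc : b + c = 2 * k + 1) :
    ∃ A C : ℤ, HasRoot a A ∧ HasRoot (a + 2 * k + 1) C ∧
      (A + C) % 2 = 1 ∧ A ^ 2 + C ^ 2 = 4 * a + 4 * k + 1 := by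
  have hbc' : (b + c : ℤ) = 2 * k + 1 := by exact_mod_cast hbc
  obtain ⟨A, C, hA, hC, ⟨h1, h2⟩ | ⟨h1, h2⟩⟩ := hΔ.exists_roots h
  · exact absurd (h2.trans (by rw [hbc']; ring)) (sq_sub_sq_ne_of_even_add (m := k) h1)
  · refine ⟨A, C, hA, ?_, h1, by linarith⟩
    rwa [show (a + 2 * k + 1 : ℤ) = a + b + c by linarith]

theorem not_elementary_of_const_low {Δ Δ' : Block} (hΔ : IsElementaryBlock Δ)
    (hΔ' : IsElementaryBlock Δ') {b c k : ℕ} (h : HasSlices Δ k k k) (h' : HasSlices Δ' k b c)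
    (hbc : b + c = 2 * k + 1) : False := by
  obtain ⟨A, C, hA, hC, p, e⟩ := hΔ.exists_roots_of_eq h
  obtain ⟨A', C', hA', hC', p', e'⟩ := hΔ'.exists_roots_of_ne h' hbc
  obtain rfl := hA.unique hA'
  have h1 := hC.mono hC' (by linarith)
  have h2 : C' ≤ C + 1 := hC.le_add_one (by convert hC' using 1; ring)
  obtain rfl : C' = C + 1 := by omega
  obtain ⟨h3, h4, h5⟩ := hA
  obtain ⟨h6, -, -⟩ := hC
  -- Elimination of k. Then C² = A² + 4k and 2k ≤ A(A + 1) give C ≤ A, which is incompatible with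
  -- this equation.
  have h7 : C ^ 2 = 3 * A ^ 2 + 2 * C := by nlinarith
  have h8 : C ≤ A := by nlinarith
  nlinarith

theorem not_elementary_of_const_high {Δ Δ' : Block} (hΔ : IsElementaryBlock Δ)
    (hΔ' : IsElementaryBlock Δ') {b c k : ℕ} (h : HasSlices Δ (k + 1) (k + 1) (k + 1))
    (h' : HasSlices Δ' (k + 1) b c) (hbc : b + c = 2 * k + 1) : False := by
  obtain ⟨A, C, hA, hC, p, e⟩ := hΔ.exists_roots_of_eq h
  obtain ⟨A', C', hA', hC', p', e'⟩ := hΔ'.exists_roots_of_ne h' hbc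
  obtain rfl := hA.unique hA'
  push_cast at hA hC hC' e e'
  have h1 := hC'.mono hC (by linarith)
  have h2 : C ≤ C' + 1 := hC'.le_add_one (by convert hC using 1; ring)
  obtain rfl : C = C' + 1 := by omega
  -- Elimination of k leaves a square congruent to 2 modulo 3.
  have h7 : (C' + 2) ^ 2 = 3 * A ^ 2 + 5 := by nlinarith
  have h8 : (C' + 2) ^ 2 % 3 = 2 := by omega
  have h9 : (C' + 2) % 3 = 0 ∨ (C' + 2) % 3 = 1 ∨ (C' + 2) % 3 = 2 := by omega
  rcases h9 with h | h | h <;> simp [pow_two, Int.mul_emod, h] at h8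

/-- The increments B² - A² and D² - C² would add up to 4. Each is 0, or an odd number ≥ 3 (a step by
one), or, for D only, at least 8, and no such sum is 4. -/
theorem roots_sq_contradiction {a A B C D : ℤ} (hA : HasRoot a A) (hB : HasRoot (a + 1) B)
    (hC : 1 ≤ C) (hCD : C ≤ D) (h : D ^ 2 + B ^ 2 = C ^ 2 + A ^ 2 + 4) : False := by
  have h1 := hA.mono hB (by linarith)
  have h2 := hA.le_add_one hB
  have h0 := hA.1
  rcases (by omega : B = A ∨ B = A + 1) with rfl | rfl
  · rcases (by omega : D = C ∨ D = C + 1 ∨ C + 2 ≤ D) with rfl | rfl | h3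
    · nlinarith
    · have : 2 * C = 3 := by nlinarith
      omega
    · nlinarith
  · rcases (by omega : D = C ∨ C + 1 ≤ D) with rfl | h3
    · have : 2 * A = 3 := by nlinarith
      omega
    · nlinarith

/-- If the first slices differ, subtracting the two elementary relations leads to
`roots_sq_contradiction`. If they agree, the first roots agree, parity makes the last roots
consecutive, and the bounds on A conclude. -/
theorem not_elementary_of_weights_one_two {Δ Δ' : Block} (hΔ : IsElementaryBlock Δ)
    (hΔ' : IsElementaryBlock Δ') {a b c a' b' c' k : ℕ} (hk : 1 ≤ k)
    (h : HasSlices Δ a b c) (h' : HasSlices Δ' a' b' c')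
    (hw : a = k ∧ b + c = 2 * k + 1 ∨ a = k + 1 ∧ b = k ∧ c = k)
    (hw' : a' = k + 1 ∧ b' + c' = 2 * k + 1 ∨ a' = k ∧ b' = k + 1 ∧ c' = k + 1) : False := by
  have hk' : (1 : ℤ) ≤ k := by exact_mod_cast hk
  rcases hw with ⟨rfl, hbc⟩ | ⟨rfl, rfl, rfl⟩ <;> rcases hw' with ⟨rfl, hbc'⟩ | ⟨rfl, rfl, rfl⟩
  · obtain ⟨A, C, hA, hC, p, e⟩ := hΔ.exists_roots_of_ne h hbc
    obtain ⟨B, D, hB, hD, p', e'⟩ := hΔ'.exists_roots_of_ne h' hbc'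
    push_cast at hB hD e'
    exact roots_sq_contradiction hA hB hC.1 (hC.mono hD (by linarith)) (by linarith)
  · obtain ⟨A, C, hA, hC, p, e⟩ := hΔ.exists_roots_of_ne h hbc
    obtain ⟨B, D, hB, hD, p', e'⟩ := hΔ'.exists_roots_of_eq h'
    push_cast at hD e'
    obtain rfl := hA.unique hB
    have h1 := hC.mono hD (by linarith)
    have h2 : D ≤ C + 1 := hC.le_add_one (by convert hD using 1; ring)
    obtain rfl : D = C + 1 := by omega
    obtain ⟨h3, h4, h5⟩ := hA
    have h6 := hC.1
    -- Elimination of k. The lower bound A(A - 1) + 2 ≤ 2k then makes C too small compared with A.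
    have h7 : (C + 2) ^ 2 = 3 * A ^ 2 + 9 := by nlinarith
    have h8 : C + 2 ≤ A + 1 := by nlinarith
    nlinarith
  · obtain ⟨A, C, hA, hC, p, e⟩ := hΔ.exists_roots_of_eq h
    obtain ⟨B, D, hB, hD, p', e'⟩ := hΔ'.exists_roots_of_ne h' hbc'
    push_cast at hA hC hB hD e'
    obtain rfl := hA.unique hB
    have h1 := hC.mono hD (by linarith)
    have h2 : D ≤ C + 1 := hC.le_add_one (by convert hD using 1; ring)
    obtain rfl : D = C + 1 := by omega
    obtain ⟨h3, h4, h5⟩ := hA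
    have h6 := hC.1
    have h7 : (C - 1) ^ 2 = 3 * A ^ 2 - 3 := by nlinarith
    have h8 : C - 1 ≤ A - 1 := by nlinarith
    -- The only solution left by these bounds is A = C = 1, which would mean k = 0.
    nlinarith
  · obtain ⟨A, C, hA, hC, p, e⟩ := hΔ.exists_roots_of_eq h
    obtain ⟨B, D, hB, hD, p', e'⟩ := hΔ'.exists_roots_of_eq h'
    push_cast at hA hC hD e'
    exact roots_sq_contradiction hB hA hC.1 (hC.mono hD (by linarith)) (by linarith)

/-! ### Balanced sequences of two letters -/

/-- The sequence `s` has the letters `a` and `b`, the number of letters `b` among the first `n`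
terms is `P n`, and the letter `b` occurs in each factor with a frequency close to `β`. -/
structure IsBalancedCoding (s : ℕ → ℕ) (a b : ℕ) (β : ℝ) (P : ℕ → ℤ) : Prop where
  ne : a ≠ b
  zero : P 0 = 0
  letter : ∀ n, s n = a ∧ P (n + 1) = P n ∨ s n = b ∧ P (n + 1) = P n + 1
  balanced : ∀ m n : ℕ, |((P (n + m) - P n : ℤ) : ℝ) - β * m| < 1

/-- Turns an exact arithmetic progression of the counts `P` into an exact value of β, since the
discrepancy stays bounded. -/
theorem eq_zero_of_bounded_mul {t B : ℝ} (h : ∀ n : ℕ, |t * n| ≤ B) : t = 0 := by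
  by_contra ht
  obtain ⟨n, hn⟩ := exists_nat_gt (B / |t|)
  have h1 := h n
  rw [div_lt_iff₀ (abs_pos.2 ht)] at hn
  rw [abs_mul, Nat.abs_cast] at h1
  linarith

namespace IsBalancedCoding

variable {s : ℕ → ℕ} {a b : ℕ} {β : ℝ} {P : ℕ → ℤ}

theorem swap (h : IsBalancedCoding s a b β P) :
    IsBalancedCoding s b a (1 - β) (fun n => n - P n) where
  ne := h.ne.symm
  zero := by simp [h.zero]
  letter n := by
    rcases h.letter n with ⟨h1, h2⟩ | ⟨h1, h2⟩
    · exact Or.inr ⟨h1, by push_cast; omega⟩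
    · exact Or.inl ⟨h1, by push_cast; omega⟩
  balanced m n := by
    have := h.balanced m n
    rw [abs_sub_comm] at this
    convert this using 2
    push_cast
    ring

theorem eq_or_eq (h : IsBalancedCoding s a b β P) (n : ℕ) : s n = a ∨ s n = b :=
  (h.letter n).imp And.left And.left

theorem card_filter (h : IsBalancedCoding s a b β P) (n : ℕ) :
    (((Finset.range n).filter (fun j => s j = b)).card : ℤ) = P n := by
  induction n with
  | zero => simp [h.zero]
  | succ n ih =>
    rw [Finset.range_add_one, Finset.filter_insert]
    rcases h.letter n with ⟨h1, h2⟩ | ⟨h1, h2⟩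
    · rw [if_neg (by rw [h1]; exact h.ne), h2, ih]
    · rw [if_pos h1, Finset.card_insert_of_notMem (by simp), h2]
      push_cast
      rw [ih]

theorem hasFrequency (h : IsBalancedCoding s a b β P) : HasFrequency s b β := by
  unfold HasFrequency
  rw [tendsto_iff_dist_tendsto_zero]
  refine squeeze_zero' (Eventually.of_forall fun _ => dist_nonneg) ?_
    (tendsto_one_div_atTop_nhds_zero_nat (𝕜 := ℝ))
  filter_upwards [eventually_gt_atTop 0] with n hn
  have hn' : (0 : ℝ) < n := by exact_mod_cast hn
  have h1 := h.balanced n 0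
  have h2 : (((Finset.range n).filter (fun j => s j = b)).card : ℝ) = P n := by
    exact_mod_cast h.card_filter n
  rw [zero_add, h.zero, sub_zero] at h1
  rw [Real.dist_eq, h2, show (P n : ℝ) / n - β = (P n - β * n) / n by field_simp, abs_div,
    abs_of_pos hn']
  exact div_le_div_of_nonneg_right h1.le hn'.le

theorem hasFrequency_left (h : IsBalancedCoding s a b β P) : HasFrequency s a (1 - β) :=
  h.swap.hasFrequency

theorem mem_range_right (h : IsBalancedCoding s a b β P) (hβ : β ≠ 0) : b ∈ Set.range s := by
  by_contra hb
  refine hβ (eq_zero_of_bounded_mul (B := 1) fun n => ?_)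
  have hP : ∀ n, P n = 0 := by
    intro n
    induction n with
    | zero => exact h.zero
    | succ n ih =>
      rcases h.letter n with ⟨h1, h2⟩ | ⟨h1, h2⟩
      · rw [h2, ih]
      · exact absurd ⟨n, h1⟩ hb
  have := (h.balanced n 0).le
  rwa [hP, hP, sub_zero, Int.cast_zero, zero_sub, abs_neg] at this

theorem mem_range_left (h : IsBalancedCoding s a b β P) (hβ : β ≠ 1) : a ∈ Set.range s :=
  h.swap.mem_range_right (sub_ne_zero.2 hβ.symm)

theorem nonneg (h : IsBalancedCoding s a b β P) : 0 ≤ β :=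
  ge_of_tendsto' h.hasFrequency fun _ => by positivity

theorem eq_left_of_eq_zero (h : IsBalancedCoding s a b 0 P) (n : ℕ) : s n = a := by
  rcases h.letter n with ⟨h1, h2⟩ | ⟨h1, h2⟩
  · exact h1
  · have := h.balanced 1 n
    simp [h2] at this

/-- The sum of the letters over `m` terms is `1` if `β m = 1`. -/
theorem sub_eq_one (h : IsBalancedCoding s a b β P) {m : ℕ} (hm : β * m = 1) (n : ℕ) :
    P (n + m) = P n + 1 := by
  have := h.balanced m n
  rw [hm, abs_lt] at this
  have h1 : (0 : ℝ) < ((P (n + m) - P n : ℤ) : ℝ) := by linarith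
  have h2 : ((P (n + m) - P n : ℤ) : ℝ) < (2 : ℤ) := by push_cast at this ⊢; linarith
  rw [Int.cast_pos] at h1
  rw [Int.cast_lt] at h2
  omega

theorem isLeadingSlice_iff {S y : ℝ} (h : IsBalancedCoding (slice S y) a b β P) (hβ : β < 1 / 2)
    (c : ℕ) : IsLeadingSlice S y c ↔ c = a := by
  have ha := h.mem_range_left (by linarith)
  have hf := h.hasFrequency
  have hf' := h.hasFrequency_left
  constructor
  · rintro ⟨⟨n, rfl⟩, d, hd, hd'⟩
    rcases h.eq_or_eq n with hn | hn
    · exact hn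
    · rw [hn] at hd
      obtain rfl := tendsto_nhds_unique hd hf
      obtain ⟨e, he, he'⟩ := hd' a ha
      obtain rfl := tendsto_nhds_unique he' hf'
      linarith
  · rintro rfl
    refine ⟨ha, 1 - β, hf', ?_⟩
    rintro _ ⟨n, rfl⟩
    rcases h.eq_or_eq n with hn | hn
    · exact ⟨1 - β, le_rfl, hn ▸ hf'⟩
    · exact ⟨β, by linarith, hn ▸ hf⟩

/-- If `b` occurs only at multiples of `3`, then `1 / β` is a multiple of `3`. -/
theorem exists_gap (h : IsBalancedCoding s a b β P) (hβ : 0 < β)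
    (hs : ∀ n, s n = b → n % 3 = 0) : ∃ q : ℕ, β * (3 * q : ℕ) = 1 := by
  have hstep : ∀ n, n % 3 ≠ 0 → P (n + 1) = P n := by
    intro n hn
    rcases h.letter n with ⟨-, h2⟩ | ⟨h1, -⟩
    · exact h2
    · exact absurd (hs n h1) hn
  -- The number q is chosen so that 3q - 2 ≤ 1/β ≤ 3q + 2.
  obtain ⟨q, hq1, hq2⟩ : ∃ q : ℕ, 1 ≤ β * (3 * q + 2) ∧ β * (3 * q) ≤ 1 + 2 * β := by
    refine ⟨⌊(1 / β + 2) / 3⌋₊, ?_, ?_⟩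
    · have := Nat.lt_floor_add_one ((1 / β + 2) / 3)
      rw [div_lt_iff₀ (by norm_num)] at this
      have h1 : 1 / β ≤ 3 * (⌊(1 / β + 2) / 3⌋₊ : ℝ) + 2 := by linarith
      rwa [div_le_iff₀' hβ] at h1
    · have h0 : 0 < 1 / β := by positivity
      have := Nat.floor_le (a := (1 / β + 2) / 3) (by positivity)
      have h1 : 3 * (⌊(1 / β + 2) / 3⌋₊ : ℝ) ≤ 1 / β + 2 := by linarith
      calc β * (3 * (⌊(1 / β + 2) / 3⌋₊ : ℝ)) ≤ β * (1 / β + 2) := by gcongr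
        _ = 1 + 2 * β := by field_simp
  -- As `P` does not move at the positions 1 and 2 modulo 3, a window of length 3q from 3N + 3 has
  -- the same count as one shortened to 3q - 2 (count < 2) and one lengthened to 3q + 2 (count > 0).
  have hgap : ∀ N, P (3 * (N + q) + 3) = P (3 * N + 3) + 1 := by
    refine fun N => le_antisymm ?_ ?_
    · rcases Nat.eq_zero_or_pos q with rfl | hq
      · simp
      obtain ⟨r, rfl⟩ : ∃ r, q = r + 1 := ⟨q - 1, by omega⟩
      have h1 := h.balanced (3 * r + 1) (3 * N + 3)
      have h2 := hstep (3 * N + 3 + (3 * r + 1)) (by omega)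
      have h3 := hstep (3 * N + 3 + (3 * r + 1) + 1) (by omega)
      rw [show 3 * (N + (r + 1)) + 3 = 3 * N + 3 + (3 * r + 1) + 1 + 1 by ring, h3, h2]
      rw [abs_lt] at h1
      have h4 : ((P (3 * N + 3 + (3 * r + 1)) - P (3 * N + 3) : ℤ) : ℝ) < (2 : ℤ) := by
        push_cast at h1 hq2 ⊢
        linarith
      rw [Int.cast_lt] at h4
      omega
    · have h1 := h.balanced (3 * q + 2) (3 * N + 1)
      have h2 := hstep (3 * N + 1) (by omega)
      have h3 := hstep (3 * N + 1 + 1) (by omega)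
      rw [show 3 * (N + q) + 3 = 3 * N + 1 + (3 * q + 2) by ring,
        show 3 * N + 3 = 3 * N + 1 + 1 + 1 by ring, h3, h2]
      rw [abs_lt] at h1
      have h4 : (0 : ℝ) < ((P (3 * N + 1 + (3 * q + 2)) - P (3 * N + 1) : ℤ) : ℝ) := by
        push_cast at h1 hq1 ⊢
        linarith
      rw [Int.cast_pos] at h4
      omega
  refine ⟨q, ?_⟩
  have hm : ∀ m : ℕ, P (3 + 3 * q * m) = P 3 + m := by
    intro m
    induction m with
    | zero => simp
    | succ m ih =>
      rw [show 3 + 3 * q * (m + 1) = 3 * (q * m + q) + 3 by ring, hgap,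
        show 3 * (q * m) + 3 = 3 + 3 * q * m by ring, ih]
      push_cast
      ring
  have := eq_zero_of_bounded_mul (t := β * (3 * q : ℕ) - 1) (B := 1) fun m => by
    have h1 := (h.balanced (3 * q * m) 3).le
    rw [hm, abs_sub_comm] at h1
    rwa [show β * ((3 * q * m : ℕ) : ℝ) - ((P 3 + m - P 3 : ℤ) : ℝ) =
      (β * (3 * q : ℕ) - 1) * m by push_cast; ring] at h1
  linarith

end IsBalancedCoding

/-! ### The slicing sequence of an admissible orbit -/

/-- The first time at which the ordinate of the ball exceeds `n`. -/
noncomputable def hitTime (S y : ℝ) (n : ℕ) : ℕ := ⌈(n - y) / S⌉₊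

section Slices

variable {S y : ℝ}

theorem IsAdmissible.slope_pos (h : IsAdmissible S y) : 0 < S := h.1.trans h.2.1

/-- The ceiling gives a weak inequality; it is strict because the ordinates are never integers. -/
theorem IsAdmissible.lt_Ty_iff (h : IsAdmissible S y) (n m : ℕ) :
    (n : ℝ) < Ty S y m ↔ hitTime S y n ≤ m := by
  have h1 : Ty S y m ≠ n := by exact_mod_cast h.2.2.2 m n
  rw [hitTime, Nat.ceil_le, div_le_iff₀ h.slope_pos, ← h1.symm.le_iff_lt, Ty_eq]
  constructor <;> intro <;> linarith

theorem IsAdmissible.lt_Ty_hitTime (h : IsAdmissible S y) (n : ℕ) :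
    (n : ℝ) < Ty S y (hitTime S y n) := (h.lt_Ty_iff n _).2 le_rfl

theorem IsAdmissible.Ty_hitTime_lt (h : IsAdmissible S y) (n : ℕ) :
    Ty S y (hitTime S y n) < n + S := by
  rcases Nat.eq_zero_or_pos (hitTime S y n) with h0 | h0
  · rw [h0, Ty_eq]
    have := h.2.1
    have : (0 : ℝ) ≤ n := n.cast_nonneg
    simp
    linarith
  · obtain ⟨m, hm⟩ : ∃ m, hitTime S y n = m + 1 := ⟨hitTime S y n - 1, by omega⟩
    have h1 : ¬ hitTime S y n ≤ m := by omega
    rw [← h.lt_Ty_iff, not_lt] at h1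
    have h2 : Ty S y m ≠ n := by exact_mod_cast h.2.2.2 m n
    have h3 := lt_of_le_of_ne h1 h2
    rw [hm, Ty_eq]
    rw [Ty_eq] at h3
    push_cast
    linarith

theorem IsAdmissible.eq_hitTime (h : IsAdmissible S y) {n m : ℕ} (h1 : (n : ℝ) < Ty S y m)
    (h2 : Ty S y m < n + S) : m = hitTime S y n := by
  refine le_antisymm ?_ ((h.lt_Ty_iff n m).1 h1)
  by_contra! hlt
  have h3 := h.lt_Ty_hitTime n
  have h4 : (hitTime S y n : ℝ) + 1 ≤ m := by exact_mod_cast hlt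
  have h5 := h.slope_pos
  rw [Ty_eq] at h2 h3
  nlinarith

theorem hitTime_zero (h : IsAdmissible S y) : hitTime S y 0 = 0 :=
  (h.eq_hitTime (by simpa [Ty_eq] using h.1) (by simpa [Ty_eq] using h.2.1)).symm

theorem hitTime_mono (h : IsAdmissible S y) {m n : ℕ} (hmn : m ≤ n) :
    hitTime S y m ≤ hitTime S y n := by
  rw [← h.lt_Ty_iff]
  have : (m : ℝ) ≤ n := by exact_mod_cast hmn
  exact this.trans_lt (h.lt_Ty_hitTime n)

theorem hitTime_add_slice (h : IsAdmissible S y) (n : ℕ) :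
    hitTime S y n + slice S y n = hitTime S y (n + 1) := by
  have h1 : {m : ℕ | (n : ℝ) < Ty S y m ∧ Ty S y m < n + 1} =
      Finset.Ico (hitTime S y n) (hitTime S y (n + 1)) := by
    ext m
    have h2 : Ty S y m ≠ (n + 1 : ℕ) := by exact_mod_cast h.2.2.2 m (n + 1 : ℕ)
    have h3 := h.lt_Ty_iff (n + 1) m
    rw [Set.mem_ofPred_eq, h.lt_Ty_iff, Finset.coe_Ico, Set.mem_Ico, ← not_le (b := m), ← h3, not_lt,
      h2.le_iff_lt]
    push_cast
    rfl
  rw [slice, h1, Set.ncard_coe_finset, Nat.card_Ico]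
  have := hitTime_mono h (Nat.le_add_right n 1)
  omega

/-- At both hitting times the ball lies above its line by an amount in (0, S), so the two excesses
differ by less than S; then divide by S. -/
theorem abs_hitTime_sub_lt (h : IsAdmissible S y) (m n : ℕ) :
    |(hitTime S y (n + m) : ℝ) - hitTime S y n - 1 / S * m| < 1 := by
  have h1 := h.lt_Ty_hitTime n
  have h2 := h.Ty_hitTime_lt n
  have h3 := h.lt_Ty_hitTime (n + m)
  have h4 := h.Ty_hitTime_lt (n + m)
  have h5 := h.slope_pos
  rw [Ty_eq] at h1 h2 h3 h4
  push_cast at h3 h4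
  have h6 : S * |(hitTime S y (n + m) : ℝ) - hitTime S y n - 1 / S * m| < S * 1 := by
    rw [← abs_of_pos h5, ← abs_mul, abs_of_pos h5, mul_sub, mul_sub, ← mul_assoc,
      mul_one_div_cancel h5.ne', abs_lt]
    constructor <;> linarith
  exact lt_of_mul_lt_mul_left h6 h5.le

/-- The slices are `k` and `k + 1`, where `k` is the integral part of `1 / S`. -/
theorem isBalancedCoding_slice (h : IsAdmissible S y) :
    IsBalancedCoding (slice S y) ⌊1 / S⌋₊ (⌊1 / S⌋₊ + 1) (1 / S - ⌊1 / S⌋₊)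
      (fun n => hitTime S y n - ⌊1 / S⌋₊ * n) where
  ne := by omega
  zero := by simp [hitTime_zero h]
  letter n := by
    have h1 := abs_hitTime_sub_lt h 1 n
    have h2 := hitTime_add_slice h n
    have h3 : 0 ≤ 1 / S := by have := h.slope_pos; positivity
    have h4 := Nat.floor_le h3
    have h5 := Nat.lt_floor_add_one (1 / S)
    rw [← h2, abs_lt] at h1
    push_cast at h1
    have h6 : (⌊1 / S⌋₊ : ℝ) < slice S y n + 1 := by linarith
    have h7 : (slice S y n : ℝ) < ⌊1 / S⌋₊ + 2 := by linarith
    norm_cast at h6 h7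
    rw [← h2]
    push_cast
    rcases (by omega : slice S y n = ⌊1 / S⌋₊ ∨ slice S y n = ⌊1 / S⌋₊ + 1) with h8 | h8
    · exact Or.inl ⟨h8, by rw [h8]; ring⟩
    · exact Or.inr ⟨h8, by rw [h8]; push_cast; ring⟩
  balanced m n := by
    have h1 := abs_hitTime_sub_lt h m n
    convert h1 using 2
    push_cast
    ring

theorem IsElementarySequence.sizeSum_eq {Δ : ℕ → Block} (hΔ : IsElementarySequence S y Δ) (N : ℕ) :
    sizeSum Δ N = hitTime S y (3 * N) := by
  induction N with
  | zero => simp [sizeSum, hitTime_zero hΔ.admissible]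
  | succ N ih =>
    obtain ⟨h1, h2⟩ := hΔ.ordinate N 2
    rw [Fin.val_two] at h1 h2
    rw [show sizeSum Δ (N + 1) = sizeSum Δ N + size (Δ N 2) from Finset.sum_range_succ _ _]
    refine hΔ.admissible.eq_hitTime ?_ ?_
    · push_cast at h1 ⊢
      linarith
    · push_cast at h2 ⊢
      linarith

theorem IsElementarySequence.hitTime_add_size {Δ : ℕ → Block} (hΔ : IsElementarySequence S y Δ)
    (N : ℕ) (i : Fin 3) :
    hitTime S y (3 * N) + size (Δ N i) = hitTime S y (3 * N + i + 1) := by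
  obtain ⟨h1, h2⟩ := hΔ.ordinate N i
  rw [← hΔ.sizeSum_eq]
  refine hΔ.admissible.eq_hitTime ?_ ?_
  · push_cast
    exact h1
  · push_cast
    exact h2

theorem IsElementarySequence.hasSlices {Δ : ℕ → Block} (hΔ : IsElementarySequence S y Δ) (N : ℕ) :
    HasSlices (Δ N) (slice S y (3 * N)) (slice S y (3 * N + 1)) (slice S y (3 * N + 2)) := by
  have h0 := hΔ.hitTime_add_size N 0
  have h1 := hΔ.hitTime_add_size N 1
  have h2 := hΔ.hitTime_add_size N 2
  have e0 := hitTime_add_slice hΔ.admissible (3 * N)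
  have e1 := hitTime_add_slice hΔ.admissible (3 * N + 1)
  have e2 := hitTime_add_slice hΔ.admissible (3 * N + 2)
  simp only [Fin.val_zero, Fin.val_one, Fin.val_two, add_zero] at h0 h1 h2
  rw [show 3 * N + 1 + 1 = 3 * N + 2 from rfl] at h1 e1
  refine ⟨?_, ?_, ?_⟩ <;> omega

end Slices

/-! ### Elementary sequences -/

/-- If all blocks of three terms had the same count w, the frequency of `b` would be w/3. -/
theorem IsBalancedCoding.exists_weight_ne {s : ℕ → ℕ} {a b : ℕ} {β : ℝ} {P : ℕ → ℤ}
    (h : IsBalancedCoding s a b β P) {w : ℤ} (hw : β * 3 ≠ w) :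
    ∃ N, P (3 * N + 3) ≠ P (3 * N) + w := by
  by_contra! hP
  have hm : ∀ m : ℕ, P (3 * m) = w * m := by
    intro m
    induction m with
    | zero => simpa using h.zero
    | succ m ih =>
      rw [mul_add_one, hP, ih]
      push_cast
      ring
  have := eq_zero_of_bounded_mul (t := β * 3 - w) (B := 1) fun m => by
    have h1 := (h.balanced (3 * m) 0).le
    rw [zero_add, hm, h.zero, abs_sub_comm] at h1
    rwa [show β * ((3 * m : ℕ) : ℝ) - ((w * m - 0 : ℤ) : ℝ) = (β * 3 - w) * m by
      push_cast; ring] at h1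
  exact hw (by linarith)

theorem IsBalancedCoding.weight_bounds {s : ℕ → ℕ} {a b : ℕ} {β : ℝ} {P : ℕ → ℤ}
    (h : IsBalancedCoding s a b β P) {w : ℤ} (hw : w < β * 3) (hw' : β * 3 < w + 1) (N : ℕ) :
    P (3 * N + 3) = P (3 * N) + w ∨ P (3 * N + 3) = P (3 * N) + w + 1 := by
  have h1 := h.balanced 3 (3 * N)
  rw [abs_lt] at h1
  push_cast at h1
  have h2 : (P (3 * N) + w : ℝ) < P (3 * N + 3) + 1 := by linarith
  have h3 : (P (3 * N + 3) : ℝ) < P (3 * N) + w + 2 := by linarith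
  norm_cast at h2 h3
  omega

/-- Here `a` becomes the leading slice: it is k if 3β ≤ 1, and k + 1, after `swap`, if 3β ≥ 2. -/
theorem IsElementarySequence.exists_coding {S y : ℝ} {Δ : ℕ → Block}
    (hΔ : IsElementarySequence S y Δ) :
    ∃ (a b : ℕ) (β : ℝ) (P : ℕ → ℤ), IsBalancedCoding (slice S y) a b β P ∧ β < 1 / 2 ∧
      (β = 0 ∨ β * 3 = 1 ∨ 0 < β ∧ ∀ n, slice S y n = b → n % 3 = 0) := by
  have hS := hΔ.admissible.slope_pos
  have hS1 : 1 ≤ 1 / S := (one_le_div hS).2 hΔ.admissible.2.2.1.le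
  have hc := isBalancedCoding_slice hΔ.admissible
  have hk : 1 ≤ ⌊1 / S⌋₊ := Nat.le_floor (by simpa using hS1)
  have hβ1 : 1 / S - ⌊1 / S⌋₊ < 1 := by linarith [Nat.lt_floor_add_one (1 / S)]
  have hβ0 := hc.nonneg
  generalize (fun n : ℕ => (hitTime S y n - ⌊1 / S⌋₊ * n : ℤ)) = P at hc
  generalize 1 / S - (⌊1 / S⌋₊ : ℝ) = β at hc hβ0 hβ1
  generalize ⌊1 / S⌋₊ = k at hc hk
  have hblock : ∀ N, ∃ x z t : ℕ, slice S y (3 * N) = x ∧ slice S y (3 * N + 1) = z ∧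
      slice S y (3 * N + 2) = t ∧ HasSlices (Δ N) x z t ∧ (x = k ∨ x = k + 1) ∧
      (z = k ∨ z = k + 1) ∧ (t = k ∨ t = k + 1) ∧
      (x + z + t : ℤ) = 3 * k + (P (3 * N + 3) - P (3 * N)) := by
    intro N
    have h0 := hc.letter (3 * N)
    have h1 := hc.letter (3 * N + 1)
    have h2 := hc.letter (3 * N + 2)
    rw [show 3 * N + 1 + 1 = 3 * N + 2 from rfl] at h1
    rw [show 3 * N + 2 + 1 = 3 * N + 3 from rfl] at h2
    refine ⟨_, _, _, rfl, rfl, rfl, hΔ.hasSlices N, ?_, ?_, ?_, ?_⟩ <;> omega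
  rcases hβ0.eq_or_lt with h0 | h0
  · exact ⟨_, _, _, _, hc, by linarith, Or.inl h0.symm⟩
  rcases lt_trichotomy (β * 3) 1 with h1 | h1 | h1
  -- Blocks contain at most one slice k + 1, and block `M'` is (k, k, k); it excludes a slice k + 1
  -- in second or third position.
  · refine ⟨_, _, _, _, hc, by linarith, Or.inr (Or.inr ⟨h0, fun n hn => ?_⟩)⟩
    have hw := hc.weight_bounds (w := 0) (by push_cast; linarith) (by push_cast; linarith)
    obtain ⟨M', hM'⟩ := hc.exists_weight_ne (w := 1) (by push_cast; linarith)
    by_contra hn3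
    obtain ⟨x, z, t, -, -, -, hs, hx, hz, ht, e⟩ := hblock M'
    have hw1 := hw M'
    have h5 : x = k ∧ z = k ∧ t = k := by omega
    rw [h5.1, h5.2.1, h5.2.2] at hs
    obtain ⟨x', z', t', e1, e2, e3, hs', hx', hz', ht', e'⟩ := hblock (n / 3)
    have hw2 := hw (n / 3)
    have h3 : n = 3 * (n / 3) + 1 ∨ n = 3 * (n / 3) + 2 := by omega
    have h4 : z' = k + 1 ∨ t' = k + 1 := by
      rcases h3 with h3 | h3 <;> rw [h3] at hn
      · exact Or.inl (e2.symm.trans hn)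
      · exact Or.inr (e3.symm.trans hn)
    obtain rfl : x' = k := by omega
    exact not_elementary_of_const_low (hΔ.elementary _) (hΔ.elementary _) hs hs' (by omega)
  · exact ⟨_, _, _, _, hc, by linarith, Or.inr (Or.inl h1)⟩
  rcases lt_trichotomy (β * 3) 2 with h2 | h2 | h2
  -- Blocks with one and with two slices k + 1 would both occur.
  · exfalso
    have hw := hc.weight_bounds (w := 1) (by push_cast; linarith) (by push_cast; linarith)
    obtain ⟨M, hM⟩ := hc.exists_weight_ne (w := 2) (by push_cast; linarith)
    obtain ⟨M', hM'⟩ := hc.exists_weight_ne (w := 1) (by push_cast; linarith)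
    obtain ⟨x, z, t, -, -, -, hs, hx, hz, ht, e⟩ := hblock M
    obtain ⟨x', z', t', -, -, -, hs', hx', hz', ht', e'⟩ := hblock M'
    have hw1 := hw M
    have hw2 := hw M'
    exact not_elementary_of_weights_one_two (hΔ.elementary _) (hΔ.elementary _) hk hs hs'
      (by omega) (by omega)
  · exact ⟨_, _, _, _, hc.swap, by linarith, Or.inr (Or.inl (by linarith))⟩
  -- Mirror case: block `M'` is (k + 1, k + 1, k + 1), and k is the rarer slice.
  · refine ⟨_, _, _, _, hc.swap, by linarith, Or.inr (Or.inr ⟨by linarith, fun n hn => ?_⟩)⟩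
    have hw := hc.weight_bounds (w := 2) (by push_cast; linarith) (by push_cast; linarith)
    obtain ⟨M', hM'⟩ := hc.exists_weight_ne (w := 2) (by push_cast; linarith)
    by_contra hn3
    obtain ⟨x, z, t, -, -, -, hs, hx, hz, ht, e⟩ := hblock M'
    have hw1 := hw M'
    obtain ⟨rfl, rfl, rfl⟩ : x = k + 1 ∧ z = k + 1 ∧ t = k + 1 := by omega
    obtain ⟨x', z', t', e1, e2, e3, hs', hx', hz', ht', e'⟩ := hblock (n / 3)
    have hw2 := hw (n / 3)
    have h3 : n = 3 * (n / 3) + 1 ∨ n = 3 * (n / 3) + 2 := by omega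
    have h4 : z' = k ∨ t' = k := by
      rcases h3 with h3 | h3 <;> rw [h3] at hn
      · exact Or.inl (e2.symm.trans hn)
      · exact Or.inr (e3.symm.trans hn)
    obtain rfl : x' = k + 1 := by omega
    exact not_elementary_of_const_high (hΔ.elementary _) (hΔ.elementary _) hs hs' (by omega)

/-! ### Periods of the slices and of the blocks -/

theorem IsElementarySequence.block_eq {S y : ℝ} {Δ : ℕ → Block}
    (hΔ : IsElementarySequence S y Δ) {M N : ℕ} (h0 : slice S y (3 * M) = slice S y (3 * N))
    (h1 : slice S y (3 * M + 1) = slice S y (3 * N + 1))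
    (h2 : slice S y (3 * M + 2) = slice S y (3 * N + 2)) : Δ M = Δ N := by
  have h := hΔ.hasSlices M
  rw [h0, h1, h2] at h
  exact h.block_unique (hΔ.hasSlices N) (hΔ.elementary M) (hΔ.elementary N)

/-- Each window of length m contains exactly one `b`. When the window slides by one place, the
letter that enters equals the one that leaves. -/
theorem IsBalancedCoding.periodic {s : ℕ → ℕ} {a b : ℕ} {β : ℝ} {P : ℕ → ℤ}
    (h : IsBalancedCoding s a b β P) {m : ℕ} (hm : β * m = 1) : Function.Periodic s m := by
  intro n
  have h1 := h.sub_eq_one hm n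
  have h2 := h.sub_eq_one hm (n + 1)
  have h3 := h.letter n
  have h4 := h.letter (n + m)
  rw [show n + 1 + m = n + m + 1 by ring] at h2
  omega

theorem IsBalancedCoding.exists_unique_letter {s : ℕ → ℕ} {a b : ℕ} {β : ℝ} {P : ℕ → ℤ}
    (h : IsBalancedCoding s a b β P) {m : ℕ} (hm : β * m = 1) :
    ∃ n < m, s n = b ∧ ∀ j < m, j ≠ n → s j = a := by
  have h1 := h.sub_eq_one hm 0
  rw [zero_add, h.zero, ← h.card_filter] at h1
  obtain ⟨n, hn⟩ := Finset.card_eq_one.1 (by exact_mod_cast h1)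
  have h2 : n ∈ (Finset.range m).filter (fun j => s j = b) := by simp [hn]
  rw [Finset.mem_filter, Finset.mem_range] at h2
  refine ⟨n, h2.1, h2.2, fun j hj hjn => (h.eq_or_eq j).resolve_right fun hb => hjn ?_⟩
  have h3 : j ∈ (Finset.range m).filter (fun j => s j = b) := by simp [hj, hb]
  simpa [hn] using h3

theorem isRotated_map_range {β : Type*} (u : ℕ → β) {q i : ℕ} {c d : β} (hi : i < q)
    (hc : ∀ j < q, j ≠ i → u j = c) (hd : u i = d) :
    (List.range q).map u ~r (List.replicate (q - 1) c ++ [d]) := by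
  obtain ⟨r, rfl⟩ : ∃ r, q = i + 1 + r := ⟨q - (i + 1), by omega⟩
  have h : (List.range (i + 1 + r)).map u =
      (List.replicate i c ++ [d]) ++ List.replicate r c := by
    rw [List.range_add, List.range_succ, List.map_append, List.map_append, List.map_map]
    congr 1
    · congr 1
      · rw [List.eq_replicate_iff]
        refine ⟨by simp, fun x hx => ?_⟩
        obtain ⟨j, hj, rfl⟩ := List.mem_map.1 hx
        rw [List.mem_range] at hj
        exact hc j (by omega) (by omega)
      · simp [hd]
    · rw [List.eq_replicate_iff]
      refine ⟨by simp, fun x hx => ?_⟩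
      obtain ⟨j, hj, rfl⟩ := List.mem_map.1 hx
      rw [List.mem_range] at hj
      exact hc (i + 1 + j) (by omega) (by omega)
  rw [h, show i + 1 + r - 1 = r + i by omega, List.replicate_add, List.append_assoc _ _ [d]]
  exact List.isRotated_append

theorem IsElementarySequence.periodic {S y : ℝ} {Δ : ℕ → Block}
    (hΔ : IsElementarySequence S y Δ) {q : ℕ} (h : Function.Periodic (slice S y) (3 * q)) :
    Function.Periodic Δ q := by
  intro N
  refine hΔ.block_eq ?_ ?_ ?_
  · rw [mul_add, h]
  · rw [mul_add, add_right_comm, h]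
  · rw [mul_add, add_right_comm, h]

/-- The shape of a period of length `> 1`, when the correcting slice occurs only as the first slice
of a block. -/
theorem IsElementarySequence.exists_isRotated {S y : ℝ} {Δ : ℕ → Block}
    (hΔ : IsElementarySequence S y Δ) {a b : ℕ} {β : ℝ} {P : ℕ → ℤ}
    (hc : IsBalancedCoding (slice S y) a b β P) (hs : ∀ n, slice S y n = b → n % 3 = 0) {q : ℕ}
    (hq : β * (3 * q : ℕ) = 1) {T : ℕ} (hT : IsMinimalPeriod Δ T) (hT1 : 1 < T) :
    ∃ Λ Λ₀ : Block, HasSlices Λ a a a ∧ HasSlices Λ₀ b a a ∧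
      ∃ k : ℕ, 0 < k ∧ (List.range T).map Δ ~r (List.replicate k Λ ++ [Λ₀]) := by
  have hne := hc.ne
  have hper := hc.periodic hq
  have hq0 : 0 < q := by
    rcases Nat.eq_zero_or_pos q with rfl | h
    · simp at hq
    · exact h
  have hTq : T ≤ q := hT.2 ⟨hq0, hΔ.periodic hper⟩
  have ha : ∀ n, n % 3 ≠ 0 → slice S y n = a := fun n hn =>
    (hc.eq_or_eq n).resolve_right fun h => hn (hs n h)
  have ha1 : ∀ N, slice S y (3 * N + 1) = a := fun N => ha _ (by omega)
  have ha2 : ∀ N, slice S y (3 * N + 2) = a := fun N => ha _ (by omega)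
  obtain ⟨n, hn, hnb, hna⟩ := hc.exists_unique_letter hq
  obtain ⟨i, rfl⟩ : ∃ i, n = 3 * i := ⟨n / 3, by have := hs n hnb; omega⟩
  -- A period T < q would carry the block opening with `b` to another residue modulo q, although `b`
  -- occurs only once in 3q consecutive slices.
  obtain rfl : T = q := by
    refine hTq.antisymm ?_
    by_contra! hlt
    have h1 : slice S y (3 * (i + T)) = b := by
      rw [← hnb, ← (hΔ.hasSlices (i + T)).1, ← (hΔ.hasSlices i).1, hT.1.2 i]
    rcases lt_or_ge (i + T) q with h2 | h2
    · exact hne ((hna _ (by omega) (by omega)).symm.trans h1)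
    · obtain ⟨j, hj⟩ := Nat.exists_eq_add_of_le' h2
      rw [hj, mul_add, hper] at h1
      exact hne ((hna _ (by omega) (by omega)).symm.trans h1)
  obtain ⟨j, hj, hji⟩ : ∃ j < T, j ≠ i := by
    rcases eq_or_ne i 0 with rfl | h
    · exact ⟨1, hT1, one_ne_zero⟩
    · exact ⟨0, by omega, h.symm⟩
  have hja := hna (3 * j) (by omega) (by omega)
  refine ⟨Δ j, Δ i, ?_, ?_, T - 1, by omega, isRotated_map_range Δ (i := i) (by omega) ?_ rfl⟩
  · have := hΔ.hasSlices j
    rwa [hja, ha1, ha2] at this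
  · have := hΔ.hasSlices i
    rwa [hnb, ha1, ha2] at this
  · intro l hl hli
    exact hΔ.block_eq (by rw [hja, hna _ (by omega) (by omega)]) (by rw [ha1, ha1])
      (by rw [ha2, ha2])

end Breakout

theorem mainTheorem2 (S y : ℝ) (Δ : ℕ → Breakout.Block)
    (hΔ : Breakout.IsElementarySequence S y Δ) :
    (∃ T : ℕ, 0 < T ∧ Function.Periodic Δ T) ∧
    (∃ χ : ℕ, Breakout.IsLeadingSlice S y χ) ∧
    ∀ χ : ℕ, Breakout.IsLeadingSlice S y χ →
      ∀ T : ℕ, Breakout.IsMinimalPeriod Δ T →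
        (T = 1 →
          Breakout.HasSlices (Δ 0) χ χ χ ∨
          ∃ χ' : ℕ, Breakout.IsLeadingAndCorrecting S y χ χ' ∧
            (Breakout.HasSlices (Δ 0) χ' χ χ ∨
             Breakout.HasSlices (Δ 0) χ χ' χ ∨
             Breakout.HasSlices (Δ 0) χ χ χ')) ∧
        (1 < T →
          ∃ χ' : ℕ, Breakout.IsLeadingAndCorrecting S y χ χ' ∧
            ∃ Λ Λ₀ : Breakout.Block,
              Breakout.HasSlices Λ χ χ χ ∧ Breakout.HasSlices Λ₀ χ' χ χ ∧
              ∃ k : ℕ, 0 < k ∧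
                (List.range T).map Δ ~r (List.replicate k Λ ++ [Λ₀])) := by
  obtain ⟨a, b, β, P, hc, hβ, hcase⟩ := hΔ.exists_coding
  have hlead := hc.isLeadingSlice_iff hβ
  have hslices := hΔ.hasSlices 0
  rw [mul_zero, zero_add, zero_add] at hslices
  suffices h : (∃ T : ℕ, 0 < T ∧ Function.Periodic Δ T) ∧ ∀ T : ℕ, Breakout.IsMinimalPeriod Δ T →
      (T = 1 → Breakout.HasSlices (Δ 0) a a a ∨ b ∈ Set.range (Breakout.slice S y) ∧
        (Breakout.HasSlices (Δ 0) b a a ∨ Breakout.HasSlices (Δ 0) a b a ∨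
          Breakout.HasSlices (Δ 0) a a b)) ∧
      (1 < T → b ∈ Set.range (Breakout.slice S y) ∧ ∃ Λ Λ₀ : Breakout.Block,
        Breakout.HasSlices Λ a a a ∧ Breakout.HasSlices Λ₀ b a a ∧
          ∃ k : ℕ, 0 < k ∧ (List.range T).map Δ ~r (List.replicate k Λ ++ [Λ₀])) by
    refine ⟨h.1, ⟨a, (hlead a).2 rfl⟩, fun χ hχ T hT => ?_⟩
    obtain rfl := (hlead χ).1 hχ
    obtain ⟨h1, h2⟩ := h.2 T hT
    refine ⟨fun hT1 => ?_, fun hT1 => ?_⟩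
    · exact (h1 hT1).imp id fun h3 => ⟨b, ⟨hχ, h3.1, hc.ne.symm⟩, h3.2⟩
    · exact ⟨b, ⟨hχ, (h2 hT1).1, hc.ne.symm⟩, (h2 hT1).2⟩
  -- The cases are: no correcting slice; exactly one in every block, at a fixed place; correcting
  -- slices only at the beginning of blocks.
  rcases hcase with rfl | h3 | ⟨hpos, hs⟩
  · have ha := hc.eq_left_of_eq_zero
    have hper : Function.Periodic Δ 1 := hΔ.periodic fun n => by rw [ha, ha]
    refine ⟨⟨1, one_pos, hper⟩, fun T hT => ⟨fun _ => Or.inl ?_, fun hT1 => ?_⟩⟩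
    · rwa [ha, ha, ha] at hslices
    · exact absurd (hT.2 ⟨one_pos, hper⟩) (not_le.2 hT1)
  · have hm : β * (3 : ℕ) = 1 := by exact_mod_cast h3
    have hper : Function.Periodic Δ 1 := hΔ.periodic (hc.periodic hm)
    refine ⟨⟨1, one_pos, hper⟩, fun T hT => ⟨fun _ => Or.inr ?_, fun hT1 => ?_⟩⟩
    · obtain ⟨n, hn, hnb, hna⟩ := hc.exists_unique_letter hm
      refine ⟨⟨n, hnb⟩, ?_⟩
      interval_cases n
      · rw [hnb, hna 1 (by omega) (by omega), hna 2 (by omega) (by omega)] at hslices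
        exact Or.inl hslices
      · rw [hnb, hna 0 (by omega) (by omega), hna 2 (by omega) (by omega)] at hslices
        exact Or.inr (Or.inl hslices)
      · rw [hnb, hna 0 (by omega) (by omega), hna 1 (by omega) (by omega)] at hslices
        exact Or.inr (Or.inr hslices)
    · exact absurd (hT.2 ⟨one_pos, hper⟩) (not_le.2 hT1)
  · obtain ⟨q, hq⟩ := hc.exists_gap hpos hs
    have hq0 : q ≠ 0 := by
      rintro rfl
      simp at hq
    have hb := hc.mem_range_right hpos.ne'
    refine ⟨⟨q, hq0.bot_lt, hΔ.periodic (hc.periodic hq)⟩, fun T hT => ⟨fun _ => ?_, fun hT1 => ?_⟩⟩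
    · have h1 := (hc.eq_or_eq 1).resolve_right fun h => absurd (hs 1 h) (by norm_num)
      have h2 := (hc.eq_or_eq 2).resolve_right fun h => absurd (hs 2 h) (by norm_num)
      rw [h1, h2] at hslices
      rcases hc.eq_or_eq 0 with h0 | h0 <;> rw [h0] at hslices
      · exact Or.inl hslices
      · exact Or.inr ⟨hb, Or.inl hslices⟩
    · exact ⟨hb, hΔ.exists_isRotated hc hs hq hT hT1⟩
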